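/- Let $n\ge 0$ and let $a=(a_1,\dots,a_n)$ be a vector of positive real numbers (for instance, positive integers). Let $\mathsf{Tes}_n(a)$ be the Tesler polytope, that is, the set of upper triangular $n\times n$ matrices $(x_{i,j})$ with nonnegative real entries such that $$x_{k,k}+\sum_{j=k+1}^{n}x_{k,j}-\sum_{i=1}^{k-1}x_{i,k}=a_k\qquad(1\le k\le n).$$ For a polytope $P$ of dimension $d$ let $f_i=f_i(P)$ be the number of faces of $P$ of dimension $i$ (the faces being the nonempty sets of maximizers on $P$ of a linear functional), and let the numbers $h_i=h_i(P)$ be defined by $\sum_{i=0}^{d}f_i(x-1)^i=\sum_{i=0}^{d}h_ix^i$. A polytope $P$ is simple if each of its vertices lies on exactly $\dim P$ edges. Then $\mathsf{Tes}_n(a)$ is a simple polytope of dimension $\binom n2$, for every $i$ the number $h_i$ of $\mathsf{Tes}_n(a)$ is the number of permutations of $\{1,\dots,n\}$ with exactly $i$ inversions (with $h_i=0$ for $i>\binom n2$), and $$\sum_{i=0}^{\binom n2}f_i(x-1)^i=\sum_{i=0}^{\binom n2}h_ix^i=[n]!_x,\qquad\text{where } [n]!_x=\prod_{i=1}^{n}(1+x+x^2+\cdots+x^{i-1}).$$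 -/

import Mathlib

open Polynomial

noncomputable section

/-- A polytope is the convex hull of finitely many points. -/
def IsPolytope {E : Type*} [AddCommGroup E] [Module ℝ E] (P : Set E) : Prop :=
  ∃ s : Set E, s.Finite ∧ P = convexHull ℝ s

/-- The nonempty faces of `P`: the nonempty sets of maximizers on `P` of a (continuous) linear
functional. A nonempty `P` is a face of itself (zero functional). -/
def IsFace {E : Type*} [AddCommGroup E] [Module ℝ E] [TopologicalSpace E] (P F : Set E) : Prop :=
  F.Nonempty ∧ IsExposed ℝ P F

/-- The dimension of a (nonempty) set: the dimension of its affine span. -/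
def polyDim {E : Type*} [AddCommGroup E] [Module ℝ E] (F : Set E) : ℕ :=
  Module.finrank ℝ (vectorSpan ℝ F)

/-- The `i`-th entry of the f-vector of `P`: the number of faces of `P` of dimension `i`. -/
def fVector {E : Type*} [AddCommGroup E] [Module ℝ E] [TopologicalSpace E]
    (P : Set E) (i : ℕ) : ℕ :=
  {F : Set E | IsFace P F ∧ polyDim F = i}.ncard

/-- The f-polynomial `∑ f_i x^i` of `P`. -/
def fPolynomial {E : Type*} [AddCommGroup E] [Module ℝ E] [TopologicalSpace E]
    (P : Set E) : ℤ[X] :=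
  ∑ i ∈ Finset.range (polyDim P + 1), C (fVector P i : ℤ) * X ^ i

/-- The h-polynomial of `P`: the f-polynomial evaluated at `x - 1`, i.e. `∑ f_i (x - 1)^i`. -/
def hPolynomial {E : Type*} [AddCommGroup E] [Module ℝ E] [TopologicalSpace E]
    (P : Set E) : ℤ[X] :=
  (fPolynomial P).comp (X - 1)

/-- The `i`-th entry of the h-vector of `P`: the `i`-th coefficient of its h-polynomial. -/
def hVector {E : Type*} [AddCommGroup E] [Module ℝ E] [TopologicalSpace E]
    (P : Set E) (i : ℕ) : ℤ :=
  (hPolynomial P).coeff i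

/-- A polytope `P` is simple if each vertex lies on exactly `dim P` edges (faces of
dimension one). -/
def IsSimplePolytope {E : Type*} [AddCommGroup E] [Module ℝ E] [TopologicalSpace E]
    (P : Set E) : Prop :=
  IsPolytope P ∧
    ∀ v : E, IsFace P {v} →
      {F : Set E | IsFace P F ∧ polyDim F = 1 ∧ v ∈ F}.encard = (polyDim P : ℕ∞)

/-- The `k`-th hook sum of a matrix: the sum of the entries of row `k` on and to the right of the
diagonal, minus the sum of the entries of column `k` above the diagonal. -/
def hookSum {n : ℕ} (M : Matrix (Fin n) (Fin n) ℝ) (k : Fin n) : ℝ :=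
  M k k + ∑ j ∈ Finset.Ioi k, M k j - ∑ i ∈ Finset.Iio k, M i k

/-- The Tesler polytope with hook sums `a`: upper triangular `n × n` real matrices with
nonnegative entries whose `k`-th hook sum is `a k` for all `k`. -/
def teslerPolytope {n : ℕ} (a : Fin n → ℝ) : Set (Matrix (Fin n) (Fin n) ℝ) :=
  {M | (∀ i j, j < i → M i j = 0) ∧ (∀ i j, 0 ≤ M i j) ∧ ∀ k, hookSum M k = a k}

/-- The number of inversions of a permutation. -/
def inversionCount {n : ℕ} (σ : Equiv.Perm (Fin n)) : ℕ :=
  {p : Fin n × Fin n | p.1 < p.2 ∧ σ p.2 < σ p.1}.ncard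

/-- The Mahonian number: the number of permutations of `n` letters with `i` inversions. -/
def mahonian (n i : ℕ) : ℕ :=
  {σ : Equiv.Perm (Fin n) | inversionCount σ = i}.ncard

/-- The `x`-factorial `[n]!_x = ∏_{i=1}^n (1 + x + ⋯ + x^(i-1))`. -/
def xFactorial (n : ℕ) : ℤ[X] :=
  ∏ i ∈ Finset.Icc 1 n, ∑ j ∈ Finset.range i, X ^ j

end

/-! A Tesler matrix is a flow: `a k > 0` enters at vertex `k`, the entry `(k, j)` passes from `k` to
`j`, and the diagonal entry leaves. Positive inflow forces a nonzero entry in every row, and this is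
the only restriction on supports. So nonempty faces correspond to the sets `S` of upper positions
meeting every row (`isFace_supportedFace`, `IsFace.eq_supportedFace`, `supportedFace_injOn`), and
the face of `S` has dimension `S.card - n` (`polyDim_supportedFace`). Combinatorially the polytope
is thus a product of simplices of dimensions `0, ..., n - 1`, one for each row.

Vertices pick one position per row and edges add one more, which gives simplicity. The sum of `f_i
(x - 1)^i` factors over rows, a row of `m` positions giving `1 + ... + x^(m-1)`. The product is also
the generating function of inversions (`sum_X_pow_inversionCount`). -/

/-! ### Inversions and the `x`-factorial. -/

theorem inversionCount_eq_card {n : ℕ} (σ : Equiv.Perm (Fin n)) :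
    inversionCount σ =
      ∑ i, (Finset.univ.filter fun j => i < j ∧ σ j < σ i).card := by
  classical
  have h : {p : Fin n × Fin n | p.1 < p.2 ∧ σ p.2 < σ p.1} =
      ↑(Finset.univ.filter fun p : Fin n × Fin n => p.1 < p.2 ∧ σ p.2 < σ p.1) := by
    ext p; simp
  rw [inversionCount, h, Set.ncard_coe_finset, Finset.card_filter, Fintype.sum_prod_type]
  simp only [Finset.card_filter]

/-- The permutation whose first letter is `p` and whose other letters are ordered as in `τ`. -/
def consPerm {n : ℕ} (q : Fin (n + 1) × Equiv.Perm (Fin n)) : Equiv.Perm (Fin (n + 1)) :=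
  ((finSuccEquiv' 0).trans q.2.optionCongr).trans (finSuccEquiv' q.1).symm

@[simp] theorem consPerm_zero {n : ℕ} (q : Fin (n + 1) × Equiv.Perm (Fin n)) :
    consPerm q 0 = q.1 := by
  simp [consPerm]

@[simp] theorem consPerm_succ {n : ℕ} (q : Fin (n + 1) × Equiv.Perm (Fin n)) (i : Fin n) :
    consPerm q i.succ = q.1.succAbove (q.2 i) := by
  have : finSuccEquiv' 0 i.succ = some i := by
    rw [← Fin.succAbove_zero_apply, finSuccEquiv'_succAbove]
  simp [consPerm, this]

theorem consPerm_bijective (n : ℕ) : Function.Bijective (consPerm (n := n)) := by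
  rw [Fintype.bijective_iff_injective_and_card]
  constructor
  · rintro ⟨p, τ⟩ ⟨p', τ'⟩ h
    have h0 : p = p' := by simpa using congrArg (fun σ => σ 0) h
    subst h0
    congr 1
    ext i
    have := congrArg (fun σ => σ i.succ) h
    simp only [consPerm_succ] at this
    rw [Fin.succAbove_right_injective this]
  · simp [Fintype.card_perm, Nat.factorial_succ]

/-- The first letter exceeds exactly `p` later ones; `succAbove` is monotone, so the remaining
inversions are those of `τ`. -/
theorem inversionCount_consPerm {n : ℕ} (p : Fin (n + 1)) (τ : Equiv.Perm (Fin n)) :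
    inversionCount (consPerm (p, τ)) = p + inversionCount τ := by
  rw [inversionCount_eq_card, inversionCount_eq_card, Fin.sum_univ_succ]
  congr 1
  · have h : (Finset.univ.filter fun j => 0 < j ∧ consPerm (p, τ) j < consPerm (p, τ) 0) =
        (Finset.univ.filter fun i : Fin n => i.castSucc < p).map
          (τ.symm.toEmbedding.trans (Fin.succEmb n)) := by
      ext j
      refine Fin.cases ?_ (fun j => ?_) j
      · simp [Fin.succ_ne_zero]
      · simp only [Finset.mem_filter_univ, consPerm_zero, consPerm_succ, Fin.succ_pos, true_and,
          Fin.succAbove_lt_iff_castSucc_lt, Finset.mem_map, Function.Embedding.trans_apply]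
        constructor
        · intro hj
          exact ⟨τ j, hj, by simp⟩
        · rintro ⟨i, hi, hij⟩
          have : τ.symm i = j := Fin.succ_injective _ hij
          rw [← this]; simpa using hi
    rw [h, Finset.card_map]
    have h2 : (Finset.univ.filter fun i : Fin n => i.castSucc < p).map Fin.castSuccEmb =
        Finset.Iio p := by
      ext j
      simp only [Finset.mem_map, Finset.mem_filter_univ, Finset.mem_Iio]
      constructor
      · rintro ⟨i, hi, rfl⟩; exact hi
      · intro hj
        exact ⟨⟨j, by omega⟩, hj, rfl⟩
    rw [← Finset.card_map Fin.castSuccEmb, h2, Fin.card_Iio]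
  · refine Finset.sum_congr rfl fun i _ => ?_
    rw [← Finset.card_map (Fin.succEmb n)]
    congr 1
    ext j
    refine Fin.cases ?_ (fun j => ?_) j
    · simp
    · simp

theorem xFactorial_succ (n : ℕ) :
    xFactorial (n + 1) = xFactorial n * ∑ j ∈ Finset.range (n + 1), X ^ j := by
  rw [xFactorial, xFactorial, Finset.prod_Icc_succ_top (by omega)]

/-- The generating function of the inversion statistic. -/
theorem sum_X_pow_inversionCount (n : ℕ) :
    ∑ σ : Equiv.Perm (Fin n), (X : ℤ[X]) ^ inversionCount σ = xFactorial n := by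
  induction n with
  | zero => simp [xFactorial, inversionCount_eq_card]
  | succ n ih =>
    rw [← (consPerm_bijective n).sum_comp, Fintype.sum_prod_type, xFactorial_succ, ← ih, mul_comm,
      Finset.sum_mul_sum, Finset.sum_range]
    simp only [inversionCount_consPerm, pow_add]

theorem coeff_xFactorial (n i : ℕ) : (xFactorial n).coeff i = mahonian n i := by
  classical
  have h : {σ : Equiv.Perm (Fin n) | inversionCount σ = i} =
      ↑(Finset.univ.filter fun σ : Equiv.Perm (Fin n) => inversionCount σ = i) := by
    ext; simp
  rw [← sum_X_pow_inversionCount, finsetSum_coeff, mahonian, h, Set.ncard_coe_finset,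
    Finset.card_filter]
  simp [coeff_X_pow, eq_comm]

/-- This is the h-polynomial of a simplex with vertex set `s`. By the binomial theorem all subsets
together give `X ^ s.card`; remove the empty set and cancel `X - 1`. -/
theorem sum_nonempty_subsets_X_sub_one {α : Type*} [DecidableEq α] (s : Finset α) :
    ∑ A ∈ s.powerset.erase ∅, (X - 1 : ℤ[X]) ^ (A.card - 1) = ∑ j ∈ Finset.range s.card, X ^ j := by
  have hne : (X - 1 : ℤ[X]) ≠ 0 := by simpa using X_sub_C_ne_zero (1 : ℤ)
  apply mul_right_cancel₀ hne
  rw [geom_sum_mul, Finset.sum_mul]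
  have h1 : ∑ A ∈ s.powerset.erase ∅, (X - 1 : ℤ[X]) ^ (A.card - 1) * (X - 1) =
      ∑ A ∈ s.powerset.erase ∅, (X - 1 : ℤ[X]) ^ A.card := by
    refine Finset.sum_congr rfl fun A hA => ?_
    have : A.card ≠ 0 := by simpa using (Finset.mem_erase.1 hA).1
    rw [← pow_succ]; congr 1; omega
  have h2 := Finset.sum_pow_mul_eq_add_pow (X - 1 : ℤ[X]) 1 s
  simp only [one_pow, mul_one, sub_add_cancel] at h2
  rw [h1, ← h2, ← Finset.sum_erase_add _ _ (Finset.empty_mem_powerset s)]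
  simp

theorem prod_Ici_geom_sum (n : ℕ) :
    ∏ k : Fin n, ∑ j ∈ Finset.range (Finset.Ici k).card, (X : ℤ[X]) ^ j = xFactorial n := by
  simp only [Fin.card_Ici]
  induction n with
  | zero => simp [xFactorial]
  | succ n ih =>
    rw [Fin.prod_univ_succ, xFactorial_succ, ← ih, mul_comm]
    simp

/-! ### Faces as supports. -/

section Faces

variable {n : ℕ}

/-- The positions on and above the diagonal. -/
def upperPairs (n : ℕ) : Finset (Fin n × Fin n) :=
  Finset.univ.filter fun p => p.1 ≤ p.2

/-- A set of positions on and above the diagonal that meets every row. -/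
def MeetsRows (S : Finset (Fin n × Fin n)) : Prop :=
  S ⊆ upperPairs n ∧ ∀ k, ∃ j, (k, j) ∈ S

/-- The points of the Tesler polytope supported on `S`. -/
def supportedFace (a : Fin n → ℝ) (S : Finset (Fin n × Fin n)) :
    Set (Matrix (Fin n) (Fin n) ℝ) :=
  {M | M ∈ teslerPolytope a ∧ ∀ i j, (i, j) ∉ S → M i j = 0}

open Classical in
/-- The set of positions of the nonzero entries. -/
noncomputable def entrySupport (M : Matrix (Fin n) (Fin n) ℝ) : Finset (Fin n × Fin n) :=
  Finset.univ.filter fun p => M p.1 p.2 ≠ 0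

theorem mem_entrySupport {M : Matrix (Fin n) (Fin n) ℝ} {i j : Fin n} :
    (i, j) ∈ entrySupport M ↔ M i j ≠ 0 := by
  simp [entrySupport]

theorem hookSum_add (M N : Matrix (Fin n) (Fin n) ℝ) (k : Fin n) :
    hookSum (M + N) k = hookSum M k + hookSum N k := by
  simp only [hookSum, Matrix.add_apply, Finset.sum_add_distrib]; ring

theorem hookSum_smul (c : ℝ) (M : Matrix (Fin n) (Fin n) ℝ) (k : Fin n) :
    hookSum (c • M) k = c * hookSum M k := by
  simp only [hookSum, Matrix.smul_apply, smul_eq_mul, ← Finset.mul_sum]; ring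

/-- The hook sums as a linear map. -/
def hookMap (n : ℕ) : Matrix (Fin n) (Fin n) ℝ →ₗ[ℝ] (Fin n → ℝ) where
  toFun := hookSum
  map_add' M N := funext (hookSum_add M N)
  map_smul' c M := funext (hookSum_smul c M)

@[simp] theorem hookMap_apply (M : Matrix (Fin n) (Fin n) ℝ) : hookMap n M = hookSum M := rfl

theorem hookSum_eq_sum_Ici (M : Matrix (Fin n) (Fin n) ℝ) (k : Fin n) :
    hookSum M k = ∑ j ∈ Finset.Ici k, M k j - ∑ i ∈ Finset.Iio k, M i k := by
  rw [hookSum, ← Finset.Ioi_insert, Finset.sum_insert (by simp)]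

/-- An off-diagonal entry `(k, j)` counts positively in hook `k` and negatively in hook `j`.
Decreasing weights `c` will bound all entries. -/
theorem sum_mul_hookSum (c : Fin n → ℝ) (M : Matrix (Fin n) (Fin n) ℝ) :
    ∑ k, c k * hookSum M k =
      ∑ k, c k * M k k + ∑ k, ∑ j ∈ Finset.Ioi k, (c k - c j) * M k j := by
  have h : ∑ k, ∑ i ∈ Finset.Iio k, c k * M i k = ∑ i, ∑ k ∈ Finset.Ioi i, c k * M i k :=
    Finset.sum_comm' (by simp)
  simp only [hookSum, mul_add, mul_sub, sub_mul, Finset.mul_sum, Finset.sum_add_distrib,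
    Finset.sum_sub_distrib, h]
  ring

/-- Here `y k` is the total flow through `k` and `t i k` the share of it that `i` sends to `k`; the
recursion runs along the order of `Fin n`. -/
theorem exists_flow (b : Fin n → ℝ) (t : Fin n → Fin n → ℝ) :
    ∃ y : Fin n → ℝ, ∀ k, y k = b k + ∑ i ∈ Finset.Iio k, y i * t i k := by
  let F : (k : Fin n) → ((i : Fin n) → i < k → ℝ) → ℝ := fun k y =>
    b k + ∑ i ∈ (Finset.Iio k).attach, y i.1 (Finset.mem_Iio.1 i.2) * t i.1 k
  refine ⟨(wellFounded_lt (α := Fin n)).fix F, fun k => ?_⟩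
  rw [WellFounded.fix_eq]
  simp only [F]
  rw [Finset.sum_attach (Finset.Iio k) fun i => (wellFounded_lt (α := Fin n)).fix F i * t i k]

theorem hookSum_flow {b y : Fin n → ℝ} {t : Fin n → Fin n → ℝ}
    (hy : ∀ k, y k = b k + ∑ i ∈ Finset.Iio k, y i * t i k)
    (ht : ∀ k, ∑ j ∈ Finset.Ici k, t k j = 1) :
    hookSum (Matrix.of fun i j => y i * t i j) = b := by
  ext k
  rw [hookSum_eq_sum_Ici]
  simp only [Matrix.of_apply, ← Finset.mul_sum, ht]
  linarith [hy k]

theorem exists_hookSum_eq {S : Finset (Fin n × Fin n)} (hS : MeetsRows S) (b : Fin n → ℝ) :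
    ∃ M, (∀ i j, (i, j) ∉ S → M i j = 0) ∧ hookSum M = b := by
  choose s hs using hS.2
  -- Each row puts its whole flow on one chosen position of `S`; signs are irrelevant here.
  obtain ⟨y, hy⟩ := exists_flow b fun i j => if j = s i then 1 else 0
  refine ⟨_, fun i j hij => ?_, hookSum_flow hy fun k => ?_⟩
  · have : j ≠ s i := fun h => hij (h ▸ hs i)
    simp [this]
  · have : k ≤ s k := by simpa [upperPairs] using hS.1 (hs k)
    simp [this]

theorem exists_mem_supportedFace {a : Fin n → ℝ} (ha : ∀ i, 0 < a i)
    {S : Finset (Fin n × Fin n)} (hS : MeetsRows S) :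
    ∃ M ∈ supportedFace a S, ∀ i j, (i, j) ∈ S → 0 < M i j := by
  classical
  let c : Fin n → ℝ := fun i => ∑ j ∈ Finset.Ici i, if (i, j) ∈ S then 1 else 0
  have hup : ∀ i j, (i, j) ∈ S → i ≤ j := fun i j h => by simpa [upperPairs] using hS.1 h
  have hc : ∀ i, 0 < c i := fun i => by
    obtain ⟨j, hj⟩ := hS.2 i
    refine Finset.sum_pos' (fun j _ => by split_ifs <;> norm_num) ⟨j, ?_, by simp [hj]⟩
    simpa using hup i j hj
  -- Each row splits its flow equally among its positions in `S`, so all of them become positive.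
  let t : Fin n → Fin n → ℝ := fun i j => (if (i, j) ∈ S then 1 else 0) / c i
  have ht0 : ∀ i j, 0 ≤ t i j := fun i j => by
    have := (hc i).le
    simp only [t]; split_ifs <;> positivity
  have ht : ∀ k, ∑ j ∈ Finset.Ici k, t k j = 1 := fun k => by
    simp only [t, ← Finset.sum_div]
    exact div_self (hc k).ne'
  obtain ⟨y, hy⟩ := exists_flow a t
  have hy0 : ∀ k, 0 < y k := fun k => by
    induction k using WellFoundedLT.induction with
    | ind k ih =>
      rw [hy k]
      refine add_pos_of_pos_of_nonneg (ha k) (Finset.sum_nonneg fun i hi => ?_)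
      exact mul_nonneg (ih i (Finset.mem_Iio.1 hi)).le (ht0 i k)
  have hz : ∀ i j, (i, j) ∉ S → y i * t i j = 0 := fun i j h => by simp [t, h]
  refine ⟨_, ⟨⟨fun i j hij => hz i j fun h => ?_, fun i j => mul_nonneg (hy0 i).le (ht0 i j),
    fun k => congrFun (hookSum_flow hy ht) k⟩, hz⟩, fun i j h => ?_⟩
  · exact absurd (hup i j h) (not_le.2 hij)
  · have := hc i
    have := hy0 i
    simp only [t, h, if_true]
    positivity

theorem meetsRows_entrySupport {a : Fin n → ℝ} (ha : ∀ i, 0 < a i)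
    {M : Matrix (Fin n) (Fin n) ℝ} (hM : M ∈ teslerPolytope a) : MeetsRows (entrySupport M) := by
  refine ⟨fun p hp => ?_, fun k => ?_⟩
  · obtain ⟨i, j⟩ := p
    rw [mem_entrySupport] at hp
    simp only [upperPairs, Finset.mem_filter_univ]
    by_contra h
    exact hp (hM.1 i j (not_le.1 h))
  · by_contra! h
    simp only [mem_entrySupport, not_not] at h
    have h1 := hM.2.2 k
    rw [hookSum_eq_sum_Ici, Finset.sum_eq_zero fun j _ => h j] at h1
    have h2 : 0 ≤ ∑ i ∈ Finset.Iio k, M i k := Finset.sum_nonneg fun i _ => hM.2.1 i k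
    linarith [ha k]

theorem mem_supportedFace_iff {a : Fin n → ℝ} {S : Finset (Fin n × Fin n)}
    {M : Matrix (Fin n) (Fin n) ℝ} :
    M ∈ supportedFace a S ↔ M ∈ teslerPolytope a ∧ entrySupport M ⊆ S := by
  refine and_congr_right fun _ => ⟨fun h p hp => ?_, fun h i j hij => ?_⟩
  · by_contra hpS
    exact mem_entrySupport.1 hp (h p.1 p.2 hpS)
  · by_contra h0
    exact hij (h (mem_entrySupport.2 h0))

theorem exists_entrySupport_eq {a : Fin n → ℝ} (ha : ∀ i, 0 < a i)
    {S : Finset (Fin n × Fin n)} (hS : MeetsRows S) :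
    ∃ M ∈ teslerPolytope a, entrySupport M = S := by
  obtain ⟨M, hM, hpos⟩ := exists_mem_supportedFace ha hS
  refine ⟨M, hM.1, (mem_supportedFace_iff.1 hM).2.antisymm fun p hp => ?_⟩
  exact mem_entrySupport.2 (hpos _ _ hp).ne'

theorem supportedFace_subset_iff {a : Fin n → ℝ} (ha : ∀ i, 0 < a i)
    {S T : Finset (Fin n × Fin n)} (hS : MeetsRows S) :
    supportedFace a S ⊆ supportedFace a T ↔ S ⊆ T := by
  constructor
  · intro h
    obtain ⟨M, hM, rfl⟩ := exists_entrySupport_eq ha hS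
    exact (mem_supportedFace_iff.1 (h (mem_supportedFace_iff.2 ⟨hM, subset_rfl⟩))).2
  · intro h M hM
    rw [mem_supportedFace_iff] at hM ⊢
    exact ⟨hM.1, hM.2.trans h⟩

theorem supportedFace_injOn {a : Fin n → ℝ} (ha : ∀ i, 0 < a i) :
    Set.InjOn (supportedFace a) {S | MeetsRows S} := fun _ hS _ hT h =>
  ((supportedFace_subset_iff ha hS).1 h.subset).antisymm
    ((supportedFace_subset_iff ha hT).1 h.superset)

/-- Zero entries of `M` do not move, and positive ones survive a small change of either sign. -/
theorem exists_perturbation {a : Fin n → ℝ} {M V : Matrix (Fin n) (Fin n) ℝ}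
    (hM : M ∈ teslerPolytope a) (hV : hookSum V = 0) (hMV : entrySupport V ⊆ entrySupport M) :
    ∃ ε : ℝ, 0 < ε ∧ M + ε • V ∈ teslerPolytope a ∧ M - ε • V ∈ teslerPolytope a := by
  have hz : ∀ i j, M i j = 0 → V i j = 0 := fun i j h => by
    by_contra h0
    exact mem_entrySupport.1 (hMV (mem_entrySupport.2 h0)) h
  have hev : ∀ᶠ ε : ℝ in nhdsWithin 0 (Set.Ioi 0), ∀ i j, ε * |V i j| ≤ M i j := by
    refine Filter.eventually_all.2 fun i => Filter.eventually_all.2 fun j => ?_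
    rcases (hM.2.1 i j).eq_or_lt with h | h
    · simp [hz i j h.symm, ← h]
    · have hc : Filter.Tendsto (fun ε : ℝ => ε * |V i j|) (nhds 0) (nhds (0 * |V i j|)) :=
        (continuous_id.mul continuous_const).tendsto 0
      rw [zero_mul] at hc
      exact nhdsWithin_le_nhds ((hc.eventually_lt_const h).mono fun _ => le_of_lt)
  obtain ⟨ε, hε, hpos⟩ := (hev.and self_mem_nhdsWithin).exists
  have key : ∀ δ : ℝ, |δ| = ε → M + δ • V ∈ teslerPolytope a := fun δ hδ => by
    refine ⟨fun i j hij => ?_, fun i j => ?_, fun k => ?_⟩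
    · have h0 := hM.1 i j hij
      simp [h0, hz i j h0]
    · have h1 := hε i j
      rw [← hδ, ← abs_mul] at h1
      have h2 := neg_abs_le (δ * V i j)
      simp only [Matrix.add_apply, Matrix.smul_apply, smul_eq_mul]
      linarith
    · rw [hookSum_add, hookSum_smul, hM.2.2, congrFun hV k]
      simp
  refine ⟨ε, hpos, key ε (abs_of_pos hpos), ?_⟩
  have := key (-ε) (by rw [abs_neg, abs_of_pos hpos])
  rwa [neg_smul, ← sub_eq_add_neg] at this

theorem entrySupport_sub_subset (M N : Matrix (Fin n) (Fin n) ℝ) :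
    entrySupport (M - N) ⊆ entrySupport M ∪ entrySupport N := by
  rintro ⟨i, j⟩ h
  simp only [Finset.mem_union, mem_entrySupport, Matrix.sub_apply] at *
  by_contra! h0
  exact h (by simp [h0])

theorem hookSum_sub_eq_zero {a : Fin n → ℝ} {M N : Matrix (Fin n) (Fin n) ℝ}
    (hM : M ∈ teslerPolytope a) (hN : N ∈ teslerPolytope a) : hookSum (M - N) = 0 := by
  have h : hookMap n (M - N) = hookMap n M - hookMap n N := map_sub _ _ _
  ext k
  have := congrFun h k
  simpa [hM.2.2 k, hN.2.2 k] using this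

theorem convex_teslerPolytope (a : Fin n → ℝ) : Convex ℝ (teslerPolytope a) := by
  intro M hM N hN s t hs ht hst
  refine ⟨fun i j hij => ?_, fun i j => ?_, fun k => ?_⟩
  · simp [hM.1 i j hij, hN.1 i j hij]
  · have := hM.2.1 i j
    have := hN.2.1 i j
    simp only [Matrix.add_apply, Matrix.smul_apply, smul_eq_mul]
    positivity
  · rw [hookSum_add, hookSum_smul, hookSum_smul, hM.2.2, hN.2.2, ← add_mul, hst, one_mul]

theorem isFace_supportedFace {a : Fin n → ℝ} (ha : ∀ i, 0 < a i)
    {S : Finset (Fin n × Fin n)} (hS : MeetsRows S) :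
    IsFace (teslerPolytope a) (supportedFace a S) := by
  classical
  obtain ⟨N, hN, hNS⟩ := exists_entrySupport_eq ha hS
  refine ⟨⟨N, mem_supportedFace_iff.2 ⟨hN, hNS.subset⟩⟩, fun _ => ?_⟩
  -- Minus the sum of the entries off `S`: at most `0` on the polytope, with equality exactly on the
  -- supported face.
  let f : Matrix (Fin n) (Fin n) ℝ →ₗ[ℝ] ℝ :=
    -∑ p ∈ Sᶜ, Matrix.entryLinearMap ℝ ℝ p.1 p.2
  have hf : ∀ M, f M = -∑ p ∈ Sᶜ, M p.1 p.2 := fun M => by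
    simp [f, LinearMap.neg_apply, LinearMap.sum_apply]
  have hle : ∀ M ∈ teslerPolytope a, f M ≤ 0 := fun M hM => by
    rw [hf, neg_nonpos]
    exact Finset.sum_nonneg fun p _ => hM.2.1 _ _
  have h0 : ∀ M ∈ teslerPolytope a, f M = 0 ↔ M ∈ supportedFace a S := fun M hM => by
    rw [hf, neg_eq_zero, Finset.sum_eq_zero_iff_of_nonneg fun p _ => hM.2.1 _ _]
    simp [supportedFace, hM]
  have hfN : f N = 0 := (h0 N hN).2 (mem_supportedFace_iff.2 ⟨hN, hNS.subset⟩)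
  refine ⟨LinearMap.toContinuousLinearMap f, ?_⟩
  ext M
  simp only [Set.mem_ofPred_eq, LinearMap.coe_toContinuousLinearMap']
  constructor
  · intro hM
    refine ⟨hM.1, fun y hy => ?_⟩
    rw [(h0 M hM.1).2 hM]
    exact hle y hy
  · rintro ⟨hM, hmax⟩
    exact (h0 M hM).1 (le_antisymm (hle M hM) (hfN ▸ hmax N hN))

/-- A point `M` of `F` with maximal support determines `F`: midpoints with `M` have the union of
both supports, so every support in `F` lies in that of `M`. -/
theorem IsFace.eq_supportedFace {a : Fin n → ℝ} (ha : ∀ i, 0 < a i)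
    {F : Set (Matrix (Fin n) (Fin n) ℝ)} (hF : IsFace (teslerPolytope a) F) :
    ∃ S, MeetsRows S ∧ F = supportedFace a S := by
  classical
  obtain ⟨hne, hexp⟩ := hF
  obtain ⟨l, hl⟩ := hexp hne
  have hsub : ∀ M ∈ F, M ∈ teslerPolytope a := fun M hM => by
    rw [hl] at hM
    exact hM.1
  have hconv : Convex ℝ F := hexp.convex (convex_teslerPolytope a)
  obtain ⟨_, ⟨M, hM, rfl⟩, hmax⟩ := (Set.toFinite (entrySupport '' F)).exists_maximal
    (hne.image _)
  refine ⟨entrySupport M, meetsRows_entrySupport ha (hsub M hM), Set.Subset.antisymm ?_ ?_⟩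
  · intro N hN
    rw [mem_supportedFace_iff]
    refine ⟨hsub N hN, ?_⟩
    have hmid : (1 / 2 : ℝ) • M + (1 / 2 : ℝ) • N ∈ F :=
      hconv hM hN (by norm_num) (by norm_num) (by norm_num)
    have hmem : ∀ i j, M i j ≠ 0 ∨ N i j ≠ 0 →
        (i, j) ∈ entrySupport ((1 / 2 : ℝ) • M + (1 / 2 : ℝ) • N) := fun i j h => by
      rw [mem_entrySupport]
      have h1 := (hsub M hM).2.1 i j
      have h2 := (hsub N hN).2.1 i j
      simp only [Matrix.add_apply, Matrix.smul_apply, smul_eq_mul]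
      intro h0
      rcases h with h | h
      · exact h (by linarith)
      · exact h (by linarith)
    refine Finset.Subset.trans ?_ (hmax ⟨_, hmid, rfl⟩ fun p hp =>
      hmem _ _ (Or.inl (mem_entrySupport.1 hp)))
    exact fun p hp => hmem _ _ (Or.inr (mem_entrySupport.1 hp))
  · intro N hN
    rw [mem_supportedFace_iff] at hN
    -- Moving from `M` away from `N` stays in the polytope; as `M` is a maximizer, `l N` cannot be
    -- below `l M`.
    obtain ⟨ε, hε, -, hmem⟩ := exists_perturbation (hsub M hM)
      (hookSum_sub_eq_zero hN.1 (hsub M hM))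
      ((entrySupport_sub_subset N M).trans (Finset.union_subset hN.2 subset_rfl))
    have hM' := hM
    rw [hl] at hM' ⊢
    have h1 := hM'.2 _ hmem
    simp only [map_sub, map_smul, smul_eq_mul] at h1
    have h2 : l M ≤ l N := by
      by_contra! h
      nlinarith
    exact ⟨hN.1, fun y hy => (hM'.2 y hy).trans h2⟩

/-! ### Dimensions of faces. -/

/-- The matrices supported on `S` with vanishing hook sums. -/
def supportedKer (S : Finset (Fin n × Fin n)) : Submodule ℝ (Matrix (Fin n) (Fin n) ℝ) where
  carrier := {V | entrySupport V ⊆ S ∧ hookMap n V = 0}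
  zero_mem' := ⟨fun p hp => absurd rfl (mem_entrySupport.1 hp), map_zero _⟩
  add_mem' := by
    rintro V W ⟨hV, hV0⟩ ⟨hW, hW0⟩
    refine ⟨fun p hp => ?_, by rw [map_add, hV0, hW0, add_zero]⟩
    by_contra hpS
    have h1 : V p.1 p.2 = 0 := by
      by_contra h; exact hpS (hV (mem_entrySupport.2 h))
    have h2 : W p.1 p.2 = 0 := by
      by_contra h; exact hpS (hW (mem_entrySupport.2 h))
    exact mem_entrySupport.1 hp (by simp [h1, h2])
  smul_mem' := by
    rintro c V ⟨hV, hV0⟩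
    refine ⟨fun p hp => hV (mem_entrySupport.2 fun h => mem_entrySupport.1 hp (by simp [h])), ?_⟩
    rw [map_smul, hV0, smul_zero]

theorem vectorSpan_supportedFace {a : Fin n → ℝ} (ha : ∀ i, 0 < a i)
    {S : Finset (Fin n × Fin n)} (hS : MeetsRows S) :
    vectorSpan ℝ (supportedFace a S) = supportedKer S := by
  apply le_antisymm
  · rw [vectorSpan, Submodule.span_le]
    rintro _ ⟨M, hM, N, hN, rfl⟩
    rw [mem_supportedFace_iff] at hM hN
    exact ⟨(entrySupport_sub_subset M N).trans (Finset.union_subset hM.2 hN.2),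
      hookSum_sub_eq_zero hM.1 hN.1⟩
  · rintro V ⟨hVS, hV⟩
    obtain ⟨M, hM, rfl⟩ := exists_entrySupport_eq ha hS
    obtain ⟨ε, hε, hmem, -⟩ := exists_perturbation hM hV hVS
    have h1 : M + ε • V ∈ supportedFace a (entrySupport M) := by
      refine ⟨hmem, fun i j hij => ?_⟩
      have h2 : M i j = 0 := by simpa [mem_entrySupport] using hij
      have h3 : V i j = 0 := by
        by_contra h; exact hij (hVS (mem_entrySupport.2 h))
      simp [h2, h3]
    have h2 := vsub_mem_vectorSpan ℝ h1 (mem_supportedFace_iff.2 ⟨hM, subset_rfl⟩)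
    rw [vsub_eq_sub, add_sub_cancel_left] at h2
    exact (Submodule.smul_mem_iff _ hε.ne').1 h2

open Classical in
/-- Extension by zero from the positions in `S`. -/
noncomputable def extendMatrix (S : Finset (Fin n × Fin n)) :
    (S → ℝ) →ₗ[ℝ] Matrix (Fin n) (Fin n) ℝ where
  toFun v := Matrix.of fun i j => if h : (i, j) ∈ S then v ⟨(i, j), h⟩ else 0
  map_add' v w := by
    ext i j
    by_cases h : (i, j) ∈ S <;> simp [h]
  map_smul' c v := by
    ext i j
    by_cases h : (i, j) ∈ S <;> simp [h]

theorem extendMatrix_apply (S : Finset (Fin n × Fin n)) (v : S → ℝ) (p : S) :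
    extendMatrix S v p.1.1 p.1.2 = v p := by
  simp [extendMatrix]

theorem extendMatrix_apply_of_notMem {S : Finset (Fin n × Fin n)} (v : S → ℝ) {i j : Fin n}
    (h : (i, j) ∉ S) : extendMatrix S v i j = 0 := by
  simp [extendMatrix, h]

theorem extendMatrix_restrict {S : Finset (Fin n × Fin n)} {V : Matrix (Fin n) (Fin n) ℝ}
    (h : ∀ i j, (i, j) ∉ S → V i j = 0) : extendMatrix S (fun p => V p.1.1 p.1.2) = V := by
  ext i j
  by_cases hij : (i, j) ∈ S
  · exact extendMatrix_apply S _ ⟨(i, j), hij⟩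
  · rw [extendMatrix_apply_of_notMem _ hij, h i j hij]

/-- Rank-nullity: the `n` hook sums are independent on matrices supported on `S`, by
`exists_hookSum_eq`. -/
theorem finrank_supportedKer {S : Finset (Fin n × Fin n)} (hS : MeetsRows S) :
    Module.finrank ℝ (supportedKer S) + n = S.card := by
  have hinj : Function.Injective (extendMatrix S) := fun v w h => by
    ext p
    rw [← extendMatrix_apply S v p, h, extendMatrix_apply]
  have hker : supportedKer S =
      (LinearMap.ker ((hookMap n).comp (extendMatrix S))).map (extendMatrix S) := by
    ext V
    simp only [Submodule.mem_map, LinearMap.mem_ker, LinearMap.comp_apply]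
    constructor
    · rintro ⟨hVS, hV⟩
      have := extendMatrix_restrict (S := S) (V := V) fun i j hij => by
        by_contra h; exact hij (hVS (mem_entrySupport.2 h))
      exact ⟨_, by rw [this]; exact hV, this⟩
    · rintro ⟨v, hv, rfl⟩
      refine ⟨fun p hp => ?_, hv⟩
      by_contra hpS
      exact mem_entrySupport.1 hp (extendMatrix_apply_of_notMem v hpS)
  have hsurj : LinearMap.range ((hookMap n).comp (extendMatrix S)) = ⊤ := by
    rw [LinearMap.range_eq_top]
    intro b
    obtain ⟨M, hM, hb⟩ := exists_hookSum_eq hS b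
    exact ⟨_, by rw [LinearMap.comp_apply, extendMatrix_restrict hM]; exact hb⟩
  have := LinearMap.finrank_range_add_finrank_ker ((hookMap n).comp (extendMatrix S))
  rw [hsurj, finrank_top, Module.finrank_fin_fun, Module.finrank_fintype_fun_eq_card,
    Fintype.card_coe] at this
  rw [hker, ← (Submodule.equivMapOfInjective _ hinj _).finrank_eq]
  omega

theorem polyDim_supportedFace {a : Fin n → ℝ} (ha : ∀ i, 0 < a i)
    {S : Finset (Fin n × Fin n)} (hS : MeetsRows S) :
    polyDim (supportedFace a S) + n = S.card := by
  rw [polyDim, vectorSpan_supportedFace ha hS, finrank_supportedKer hS]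

/-! ### Compactness and finitely many vertices. -/

theorem le_of_mem_teslerPolytope {a : Fin n → ℝ} {M : Matrix (Fin n) (Fin n) ℝ}
    (hM : M ∈ teslerPolytope a) (i j : Fin n) : M i j ≤ ∑ k, ((n : ℝ) - k) * a k := by
  have hc : ∀ k : Fin n, (1 : ℝ) ≤ n - k := fun k => by
    have : (k : ℝ) + 1 ≤ n := by exact_mod_cast k.2
    linarith
  have hd : ∀ k l : Fin n, k < l → (1 : ℝ) ≤ ((n : ℝ) - k) - (n - l) := fun k l h => by
    have : (k : ℝ) + 1 ≤ l := by exact_mod_cast h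
    linarith
  -- These weights are at least `1` and drop by at least `1`, so every upper entry gets coefficient
  -- at least `1`.
  have h := sum_mul_hookSum (fun k => (n : ℝ) - k) M
  simp only [hM.2.2] at h
  rw [h]
  have hdiag : ∀ k ∈ Finset.univ, 0 ≤ ((n : ℝ) - (k : Fin n)) * M k k := fun k _ =>
    mul_nonneg (by linarith [hc k]) (hM.2.1 k k)
  have hoff : ∀ k : Fin n, ∀ l ∈ Finset.Ioi k, 0 ≤ (((n : ℝ) - k) - (n - l)) * M k l :=
    fun k l hl => mul_nonneg (by linarith [hd k l (Finset.mem_Ioi.1 hl)]) (hM.2.1 k l)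
  have hoff' : ∀ k ∈ Finset.univ, 0 ≤ ∑ l ∈ Finset.Ioi k, (((n : ℝ) - k) - (n - l)) * M k l :=
    fun k _ => Finset.sum_nonneg (hoff k)
  have hM0 := hM.2.1 i j
  rcases lt_trichotomy i j with hij | rfl | hij
  · have h1 := Finset.single_le_sum (hoff i) (Finset.mem_Ioi.2 hij)
    have h2 := Finset.single_le_sum hoff' (Finset.mem_univ i)
    have h3 := Finset.sum_nonneg hdiag
    nlinarith [hd i j hij]
  · have h1 := Finset.single_le_sum hdiag (Finset.mem_univ i)
    have h2 := Finset.sum_nonneg hoff'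
    nlinarith [hc i]
  · rw [hM.1 i j hij]
    exact add_nonneg (Finset.sum_nonneg hdiag) (Finset.sum_nonneg hoff')

theorem isCompact_teslerPolytope (a : Fin n → ℝ) : IsCompact (teslerPolytope a) := by
  have hbox : IsCompact (Set.univ.pi fun _ : Fin n => Set.univ.pi fun _ : Fin n =>
      Set.Icc (0 : ℝ) (∑ k, ((n : ℝ) - k) * a k)) :=
    isCompact_univ_pi fun _ => isCompact_univ_pi fun _ => isCompact_Icc
  refine IsCompact.of_isClosed_subset (X := Fin n → Fin n → ℝ) hbox ?_ fun M hM i _ j _ =>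
    ⟨hM.2.1 i j, le_of_mem_teslerPolytope hM i j⟩
  have hent : ∀ i j, Continuous fun M : Fin n → Fin n → ℝ => M i j := fun i j => by fun_prop
  have hhook : ∀ k, Continuous fun M : Fin n → Fin n → ℝ => hookSum M k := fun k =>
    (((hent k k).add (continuous_finsetSum _ fun j _ => hent k j)).sub
      (continuous_finsetSum _ fun i _ => hent i k))
  have h : teslerPolytope a =
      ((⋂ (i) (j) (_ : j < i), {M : Fin n → Fin n → ℝ | M i j = 0}) ∩
        ((⋂ (i) (j), {M : Fin n → Fin n → ℝ | 0 ≤ M i j}) ∩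
          ⋂ k, {M : Fin n → Fin n → ℝ | hookSum M k = a k})) := by
    refine Set.ext (α := Fin n → Fin n → ℝ) fun M => ?_
    simp only [teslerPolytope, Set.mem_inter_iff, Set.mem_iInter, Set.mem_ofPred_eq]
    exact Iff.rfl
  rw [h]
  refine IsClosed.inter ?_ (IsClosed.inter ?_ ?_)
  · exact isClosed_iInter fun i => isClosed_iInter fun j => isClosed_iInter fun _ =>
      isClosed_eq (hent i j) continuous_const
  · exact isClosed_iInter fun i => isClosed_iInter fun j => isClosed_le continuous_const (hent i j)
  · exact isClosed_iInter fun k => isClosed_eq (hhook k) continuous_const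

/-- If `M` and `N` share a support, `M` is the midpoint of `M ± ε • (M - N)`. -/
theorem entrySupport_injOn_extremePoints (a : Fin n → ℝ) :
    Set.InjOn entrySupport ((teslerPolytope a).extremePoints ℝ) := by
  intro M hM N hN h
  obtain ⟨ε, hε, h1, h2⟩ := exists_perturbation hM.1 (hookSum_sub_eq_zero hM.1 hN.1)
    ((entrySupport_sub_subset M N).trans (Finset.union_subset subset_rfl h.symm.subset))
  have h3 : M ∈ openSegment ℝ (M + ε • (M - N)) (M - ε • (M - N)) :=
    ⟨1 / 2, 1 / 2, by norm_num, by norm_num, by norm_num, by module⟩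
  have h4 := hM.2 h1 h2 h3
  have h5 : ε • (M - N) = 0 := by simpa using h4
  exact sub_eq_zero.1 ((smul_eq_zero.1 h5).resolve_left hε.ne')

theorem isPolytope_teslerPolytope (a : Fin n → ℝ) : IsPolytope (teslerPolytope a) := by
  have hfin : ((teslerPolytope a).extremePoints ℝ).Finite :=
    Set.Finite.of_finite_image (Set.toFinite _) (entrySupport_injOn_extremePoints a)
  refine ⟨_, hfin, ?_⟩
  -- Krein–Milman; the closure is superfluous because the extreme points are finite in number.
  have h := closure_convexHull_extremePoints (E := Fin n → Fin n → ℝ)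
    (isCompact_teslerPolytope a) (convex_teslerPolytope a)
  have h2 : IsClosed (convexHull ℝ ((teslerPolytope a).extremePoints ℝ)) :=
    Set.Finite.isClosed_convexHull ℝ (E := Fin n → Fin n → ℝ) hfin
  rw [← h2.closure_eq]
  exact h.symm

end Faces

/-! ### Dimension and simplicity. -/

theorem card_upperPairs (n : ℕ) : (upperPairs n).card = n.choose 2 + n := by
  have h : (upperPairs n).card = ∑ k : Fin n, (Finset.Ici k).card := by
    rw [upperPairs, Finset.card_filter, Fintype.sum_prod_type]
    refine Finset.sum_congr rfl fun k _ => ?_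
    rw [← Finset.card_filter]
    congr 1
    ext j
    simp
  rw [h]
  simp only [Fin.card_Ici]
  clear h
  induction n with
  | zero => simp
  | succ n ih =>
    have := Nat.choose_succ_succ n 1
    simp only [Nat.succ_eq_add_one, Nat.reduceAdd, Nat.choose_one_right] at this
    rw [Fin.sum_univ_succ]
    simp only [Fin.val_zero, Fin.val_succ, Nat.add_sub_add_right, ih]
    omega

theorem meetsRows_upperPairs (n : ℕ) : MeetsRows (upperPairs n) :=
  ⟨subset_rfl, fun k => ⟨k, by simp [upperPairs]⟩⟩

theorem supportedFace_upperPairs {n : ℕ} (a : Fin n → ℝ) :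
    supportedFace a (upperPairs n) = teslerPolytope a := by
  ext M
  refine ⟨And.left, fun h => ⟨h, fun i j hij => h.1 i j ?_⟩⟩
  simpa [upperPairs] using hij

theorem polyDim_teslerPolytope {n : ℕ} {a : Fin n → ℝ} (ha : ∀ i, 0 < a i) :
    polyDim (teslerPolytope a) = n.choose 2 := by
  have := polyDim_supportedFace ha (meetsRows_upperPairs n)
  rw [supportedFace_upperPairs, card_upperPairs] at this
  omega

/-- A face through `v` has support set containing `S`, and dimension one leaves room for just one
more position. -/
theorem edges_eq_image {n : ℕ} {a : Fin n → ℝ} (ha : ∀ i, 0 < a i)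
    {S : Finset (Fin n × Fin n)} (hS : MeetsRows S) (hSn : S.card = n)
    {v : Matrix (Fin n) (Fin n) ℝ} (hv : v ∈ teslerPolytope a) (hvS : entrySupport v = S) :
    {F : Set (Matrix (Fin n) (Fin n) ℝ) | IsFace (teslerPolytope a) F ∧ polyDim F = 1 ∧ v ∈ F} =
      (fun p => supportedFace a (insert p S)) '' (upperPairs n \ S : Finset (Fin n × Fin n)) := by
  have hins : ∀ p ∈ upperPairs n \ S, MeetsRows (insert p S) := fun p hp =>
    ⟨Finset.insert_subset (Finset.mem_sdiff.1 hp).1 hS.1, fun k =>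
      (hS.2 k).imp fun _ h => Finset.mem_insert_of_mem h⟩
  ext F
  constructor
  · rintro ⟨hF, hdim, hvF⟩
    obtain ⟨U, hU, rfl⟩ := hF.eq_supportedFace ha
    have hcard := polyDim_supportedFace ha hU
    have hSU : S ⊆ U := hvS ▸ (mem_supportedFace_iff.1 hvF).2
    obtain ⟨p, hp⟩ := Finset.card_eq_one.1
      (show (U \ S).card = 1 by rw [Finset.card_sdiff_of_subset hSU]; omega)
    have hUS : insert p S = U := by
      rw [Finset.insert_eq, ← hp, Finset.sdiff_union_of_subset hSU]
    have hpU : p ∈ U \ S := by simp [hp]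
    exact ⟨p, Finset.mem_sdiff.2 ⟨hU.1 (Finset.mem_sdiff.1 hpU).1, (Finset.mem_sdiff.1 hpU).2⟩,
      by rw [← hUS]⟩
  · rintro ⟨p, hp, rfl⟩
    have hp' : p ∈ upperPairs n \ S := hp
    refine ⟨isFace_supportedFace ha (hins p hp'), ?_,
      mem_supportedFace_iff.2 ⟨hv, hvS ▸ Finset.subset_insert p S⟩⟩
    change polyDim (supportedFace a (insert p S)) = 1
    have := polyDim_supportedFace ha (hins p hp')
    rw [Finset.card_insert_of_notMem (Finset.mem_sdiff.1 hp').2] at this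
    omega

theorem isSimplePolytope_teslerPolytope {n : ℕ} {a : Fin n → ℝ} (ha : ∀ i, 0 < a i) :
    IsSimplePolytope (teslerPolytope a) := by
  refine ⟨isPolytope_teslerPolytope a, fun v hv => ?_⟩
  obtain ⟨S, hS, hvS⟩ := hv.eq_supportedFace ha
  have hSn : S.card = n := by
    rw [← polyDim_supportedFace ha hS, ← hvS]
    simp [polyDim]
  obtain ⟨w, hw, hwS⟩ := exists_entrySupport_eq ha hS
  have hwv : w ∈ ({v} : Set _) := hvS ▸ mem_supportedFace_iff.2 ⟨hw, hwS.subset⟩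
  obtain rfl := Set.mem_singleton_iff.1 hwv
  have hinj : Set.InjOn (fun p => supportedFace a (insert p S))
      (upperPairs n \ S : Finset (Fin n × Fin n)) := by
    intro p hp q hq hpq
    have hp' := Finset.mem_sdiff.1 (Finset.mem_coe.1 hp)
    have hq' := Finset.mem_sdiff.1 (Finset.mem_coe.1 hq)
    have hins : ∀ p ∈ upperPairs n, MeetsRows (insert p S) := fun p hp =>
      ⟨Finset.insert_subset hp hS.1, fun k => (hS.2 k).imp fun _ h => Finset.mem_insert_of_mem h⟩
    have h := supportedFace_injOn ha (hins p hp'.1) (hins q hq'.1) hpq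
    have h1 : p ∈ insert q S := h ▸ Finset.mem_insert_self p S
    exact (Finset.mem_insert.1 h1).resolve_right hp'.2
  rw [edges_eq_image ha hS hSn hw hwS, hinj.encard_image, Set.encard_coe_eq_coe_finsetCard,
    Finset.card_sdiff_of_subset hS.1, card_upperPairs, hSn, polyDim_teslerPolytope ha,
    Nat.add_sub_cancel]

/-! ### Counting faces row by row. -/

/-- The families of nonempty subsets of the rows of the upper triangle. -/
def rowFamilies (n : ℕ) : Finset (Fin n → Finset (Fin n)) :=
  Fintype.piFinset fun k => (Finset.Ici k).powerset.erase ∅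

/-- The set of positions whose rows are the members of the family `T`. -/
def familyPairs {n : ℕ} (T : Fin n → Finset (Fin n)) : Finset (Fin n × Fin n) :=
  Finset.univ.filter fun p => p.2 ∈ T p.1

theorem mem_familyPairs {n : ℕ} {T : Fin n → Finset (Fin n)} {i j : Fin n} :
    (i, j) ∈ familyPairs T ↔ j ∈ T i := by
  simp [familyPairs]

theorem mem_rowFamilies_iff {n : ℕ} {T : Fin n → Finset (Fin n)} :
    T ∈ rowFamilies n ↔ MeetsRows (familyPairs T) := by
  simp only [rowFamilies, Fintype.mem_piFinset, Finset.mem_erase, Finset.mem_powerset, MeetsRows,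
    mem_familyPairs, ← Finset.nonempty_iff_ne_empty, forall_and]
  rw [and_comm]
  refine and_congr_left fun _ => ⟨fun h => ?_, fun h k j hj => ?_⟩
  · rintro ⟨i, j⟩ hij
    simpa [upperPairs] using h i (mem_familyPairs.1 hij)
  · simpa [upperPairs] using h (mem_familyPairs.2 hj)

theorem familyPairs_injective (n : ℕ) : Function.Injective (familyPairs (n := n)) := by
  intro T U h
  ext i j
  rw [← mem_familyPairs, h, mem_familyPairs]

theorem familyPairs_surjective (n : ℕ) : Function.Surjective (familyPairs (n := n)) := fun S =>
  ⟨fun i => Finset.univ.filter fun j => (i, j) ∈ S, by ext ⟨i, j⟩; simp [mem_familyPairs]⟩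

theorem sum_card_sub_one_add {n : ℕ} {T : Fin n → Finset (Fin n)} (hT : T ∈ rowFamilies n) :
    ∑ k, ((T k).card - 1) + n = (familyPairs T).card := by
  have h : (familyPairs T).card = ∑ k, (T k).card := by
    rw [familyPairs, Finset.card_filter, Fintype.sum_prod_type]
    refine Finset.sum_congr rfl fun k _ => ?_
    simp
  have h1 : ∀ k, (T k).card = (T k).card - 1 + 1 := fun k => by
    have : (T k).card ≠ 0 := by
      simpa using (Finset.mem_erase.1 (Fintype.mem_piFinset.1 hT k)).1
    omega
  rw [h, Finset.sum_congr rfl fun k _ => h1 k, Finset.sum_add_distrib]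
  simp

theorem fVector_teslerPolytope {n : ℕ} {a : Fin n → ℝ} (ha : ∀ i, 0 < a i) (i : ℕ) :
    fVector (teslerPolytope a) i =
      ((rowFamilies n).filter fun T => ∑ k, ((T k).card - 1) = i).card := by
  have hdim : ∀ T ∈ rowFamilies n,
      polyDim (supportedFace a (familyPairs T)) = ∑ k, ((T k).card - 1) := fun T hT => by
    have h1 := polyDim_supportedFace ha (mem_rowFamilies_iff.1 hT)
    have h2 := sum_card_sub_one_add hT
    omega
  have h : {F | IsFace (teslerPolytope a) F ∧ polyDim F = i} =
      (fun T => supportedFace a (familyPairs T)) ''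
        ((rowFamilies n).filter fun T => ∑ k, ((T k).card - 1) = i) := by
    ext F
    constructor
    · rintro ⟨hF, rfl⟩
      obtain ⟨S, hS, rfl⟩ := hF.eq_supportedFace ha
      obtain ⟨T, rfl⟩ := familyPairs_surjective n S
      have hT := mem_rowFamilies_iff.2 hS
      exact ⟨T, by simp [hT, hdim T hT], rfl⟩
    · rintro ⟨T, hT, rfl⟩
      obtain ⟨hT, hi⟩ := Finset.mem_filter.1 (Finset.mem_coe.1 hT)
      exact ⟨isFace_supportedFace ha (mem_rowFamilies_iff.1 hT), (hdim T hT).trans hi⟩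
  rw [fVector, h, Set.InjOn.ncard_image, Set.ncard_coe_finset]
  intro T hT U hU hTU
  have hT := mem_rowFamilies_iff.1 (Finset.mem_filter.1 (Finset.mem_coe.1 hT)).1
  have hU := mem_rowFamilies_iff.1 (Finset.mem_filter.1 (Finset.mem_coe.1 hU)).1
  exact familyPairs_injective n (supportedFace_injOn ha hT hU hTU)

theorem sum_fVector_mul_pow {n : ℕ} {a : Fin n → ℝ} (ha : ∀ i, 0 < a i) (y : ℤ[X]) :
    ∑ i ∈ Finset.range (n.choose 2 + 1), C (fVector (teslerPolytope a) i : ℤ) * y ^ i =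
      ∑ T ∈ rowFamilies n, y ^ ∑ k, ((T k).card - 1) := by
  rw [← Finset.sum_fiberwise_of_maps_to (s := rowFamilies n) (t := Finset.range (n.choose 2 + 1))
    (g := fun T => ∑ k, ((T k).card - 1))]
  · refine Finset.sum_congr rfl fun i _ => ?_
    rw [fVector_teslerPolytope ha, Finset.sum_congr rfl fun T hT => by
      rw [(Finset.mem_filter.1 hT).2], Finset.sum_const]
    simp
  · intro T hT
    have h1 := sum_card_sub_one_add hT
    have h2 := Finset.card_le_card (mem_rowFamilies_iff.1 hT).1
    rw [card_upperPairs] at h2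
    rw [Finset.mem_range]
    omega

theorem sum_fVector_X_sub_one {n : ℕ} {a : Fin n → ℝ} (ha : ∀ i, 0 < a i) :
    ∑ i ∈ Finset.range (n.choose 2 + 1), C (fVector (teslerPolytope a) i : ℤ) * (X - 1) ^ i =
      xFactorial n := by
  rw [sum_fVector_mul_pow ha, ← prod_Ici_geom_sum]
  simp only [← sum_nonempty_subsets_X_sub_one, ← Finset.prod_pow_eq_pow_sum]
  -- Expanding the product of row sums yields one term per family of nonempty row subsets.
  rw [Finset.prod_univ_sum]
  rfl

theorem hPolynomial_teslerPolytope {n : ℕ} {a : Fin n → ℝ} (ha : ∀ i, 0 < a i) :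
    hPolynomial (teslerPolytope a) = xFactorial n := by
  rw [← sum_fVector_X_sub_one ha, hPolynomial, fPolynomial, polyDim_teslerPolytope ha]
  simp [sum_comp]

/-- Ensures that cutting the coefficient sum off at `n.choose 2` loses nothing. -/
theorem natDegree_xFactorial_le (n : ℕ) : (xFactorial n).natDegree ≤ n.choose 2 := by
  induction n with
  | zero => simp [xFactorial]
  | succ n ih =>
    rw [xFactorial_succ, Nat.choose_succ_succ' n 1, Nat.choose_one_right, add_comm n (n.choose _)]
    refine natDegree_mul_le_of_le ih (natDegree_sum_le_of_forall_le _ _ fun j hj => ?_)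
    have := Finset.mem_range.1 hj
    exact (natDegree_X_pow_le j).trans (by omega)

theorem theorem1 (n : ℕ) (a : Fin n → ℝ) (ha : ∀ i, 0 < a i) :
    IsSimplePolytope (teslerPolytope a) ∧
    polyDim (teslerPolytope a) = n.choose 2 ∧
    (∀ i : ℕ, hVector (teslerPolytope a) i = (mahonian n i : ℤ)) ∧
    ∑ i ∈ Finset.range (n.choose 2 + 1),
        C (fVector (teslerPolytope a) i : ℤ) * (X - 1) ^ i
      = ∑ i ∈ Finset.range (n.choose 2 + 1), C (hVector (teslerPolytope a) i) * X ^ i ∧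
    ∑ i ∈ Finset.range (n.choose 2 + 1), C (hVector (teslerPolytope a) i) * X ^ i
      = xFactorial n := by
  have h : ∑ i ∈ Finset.range (n.choose 2 + 1), C (hVector (teslerPolytope a) i) * X ^ i
      = xFactorial n := by
    simp only [hVector, hPolynomial_teslerPolytope ha]
    exact (as_sum_range_C_mul_X_pow' _ (Nat.lt_succ_of_le (natDegree_xFactorial_le n))).symm
  refine ⟨isSimplePolytope_teslerPolytope ha, polyDim_teslerPolytope ha, fun i => ?_, ?_, h⟩
  · rw [hVector, hPolynomial_teslerPolytope ha, coeff_xFactorial]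
  · rw [h, sum_fVector_X_sub_one ha]
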